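/- **Setting.** Let $d\ge 1$ be an integer and $p\in[1,\infty]$. For $x,y\in\mathbb R^d$ let $\langle x,y\rangle=\sum_i x_iy_i$, let $\|\cdot\|_p$ be the $\ell_p$ norm on $\mathbb R^d$ and $B_p=\{x:\|x\|_p\le 1\}$. The *Capra coupling* with source norm $\|\cdot\|_p$ is $c(x,y)=\langle x,y\rangle/\|x\|_p$ if $x\ne0$, and $c(0,y)=0$. For $f:\mathbb R^d\to[-\infty,+\infty]$ define the Capra conjugate $f^{c}(y)=\sup_{x}\big(c(x,y)-f(x)\big)$, the Capra biconjugate $f^{cc}(x)=\sup_{y}\big(c(x,y)-f^{c}(y)\big)$, and the Capra subdifferential $$\partial_c f(x)=\{y\in\mathbb R^d:\ f^{c}(y)=c(x,y)-f(x)\},\qquad \operatorname{dom}(\partial_c f)=\{x:\partial_c f(x)\neq\emptyset\}.$$ The function $f$ is *Capra-convex* if $f^{cc}=f$, and *Capra-subdifferentiable* at $x$ if $x\in\operatorname{dom}(\partial_c f)$. Let $\operatorname{supp}(x)=\{j:x_j\ne0\}$ and $\ell_0(x)=|\operatorname{supp}(x)|$. For $K\subseteq\{1,\dots,d\}$, $y_K$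 is the vector that agrees with $y$ on $K$ and vanishes outside $K$. For $C\subseteq\mathbb R^d$ and $x \in C$, $N_C(x)=\{y:\langle x'-x,y\rangle\le0\ \ \forall x'\in C\}$ is the normal cone. For $y\in\mathbb R^d$, $\nu$ denotes any permutation of $\{1,\dots,d\}$ with $|y_{\nu(1)}|\ge\dots\ge|y_{\nu(d)}|$, and for $0\le k\le d$, $1\le q<\infty$, $\|y\|^{\mathrm{top}}_{k,q}=\big(\sum_{i=1}^k|y_{\nu(i)}|^q\big)^{1/q}$ (so it is $0$ for $k=0$). **Theorem.** 1. *Case $p=1$.* One has $\ell_0^{cc}(0)=0$ and $\ell_0^{cc}(x)=1$ for every $x\ne0$; hence, if $d\ge2$, $\ell_0$ is not Capra-convex. Moreover $\operatorname{dom}(\partial_c\ell_0)=\{x:\ell_0(x)\le1\}$, $\partial_c\ell_0(0)=B_\infty$, and, if $\ell_0(x)=1$, $$\partial_c\ell_0(x)=N_{B_1}\!\Big(\frac{x}{\|x\|_1}\Big)\cap\{y:\|y\|_\infty\ge1\}.$$ 2. *Case $1<p<\infty$.* The function $\ell_0$ is Capra-convex, and $\operatorname{dom}(\partial_c\ell_0)=\mathbb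 R^d$. Moreover $\partial_c\ell_0(0)=B_\infty$, and for $x\neq0$, with $l=\ell_0(x)$, $L=\operatorname{supp}(x)$ and $\frac1p+\frac1q=1$, one has $y\in\partial_c\ell_0(x)$ if and only if - $y_L\in N_{B_p}(x/\|x\|_p)$, - $|y_j|\le\min_{i\in L}|y_i|$ for all $j\notin L$, - $|y_{\nu(k+1)}|^q\ge\big(\|y\|^{\mathrm{top}}_{k,q}+1\big)^q-\big(\|y\|^{\mathrm{top}}_{k,q}\big)^q$ for all $k\in\{0,\dots,l-1\}$, and - $|y_{\nu(l+1)}|^q\le\big(\|y\|^{\mathrm{top}}_{l,q}+1\big)^q-\big(\|y\|^{\mathrm{top}}_{l,q}\big)^q$ (when $l\ne d$). 3. *Case $p=\infty$.* One has $\ell_0^{cc}(0)=0$ and $\ell_0^{cc}(x)=\|x\|_1/\|x\|_\infty$ for every $x\ne0$; hence, if $d\ge2$, $\ell_0$ is not Capra-convex. Moreover $$\operatorname{dom}(\partial_c\ell_0)=\{x:\exists\lambda>0,\ x_k\in\{-\lambda,0,\lambda\}\ \forall k\}=\bigcup_{\lambda>0}\{-\lambda,0,\lambda\}^d,$$ $\partial_c\ell_0(0)=B_\infty$,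 and for $x\in\bigcup_{\lambda>0}\{-\lambda,0,\lambda\}^d\setminus\{0\}$, with $l=\ell_0(x)$ and $L=\operatorname{supp}(x)$, one has $y\in\partial_c\ell_0(x)$ if and only if - $y_L\in N_{B_\infty}(x/\|x\|_\infty)$, - $|y_j|\le\min_{i\in L}|y_i|$ for all $j\notin L$, - $|y_{\nu(k+1)}|\ge1$ for all $k\in\{0,\dots,l-1\}$, and - $|y_{\nu(l+1)}|\le1$ (when $l\ne d$). -/

import Mathlib

open scoped ENNReal

namespace Capra

noncomputable section

/-- The `ℓ_p` norm on `ℝ^d`, for `p ∈ [1, ∞]` (Mathlib's norm on `PiLp p`). -/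
def lpNorm {d : ℕ} (p : ℝ≥0∞) (x : Fin d → ℝ) : ℝ :=
  ‖(WithLp.toLp p x : PiLp p (fun _ : Fin d => ℝ))‖

/-- The closed unit ball of the `ℓ_p` norm. -/
def lpBall (d : ℕ) (p : ℝ≥0∞) : Set (Fin d → ℝ) :=
  {x | lpNorm p x ≤ 1}

/-- The normal cone to `C ⊆ ℝ^d` at `x`. -/
def normalCone {d : ℕ} (C : Set (Fin d → ℝ)) (x : Fin d → ℝ) : Set (Fin d → ℝ) :=
  {y | ∀ x' ∈ C, (x' - x) ⬝ᵥ y ≤ 0}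

/-- The Capra coupling associated with the source norm `N`. -/
def coupling {d : ℕ} (N : (Fin d → ℝ) → ℝ) (x y : Fin d → ℝ) : ℝ :=
  open scoped Classical in if x = 0 then 0 else (x ⬝ᵥ y) / N x

/-- The Capra (Fenchel-Moreau) conjugate of `f`. -/
def conjugate {d : ℕ} (N : (Fin d → ℝ) → ℝ) (f : (Fin d → ℝ) → EReal) (y : Fin d → ℝ) :
    EReal :=
  ⨆ x : Fin d → ℝ, (coupling N x y : EReal) - f x

/-- The Capra (Fenchel-Moreau) biconjugate of `f`. -/
def biconjugate {d : ℕ} (N : (Fin d → ℝ) → ℝ) (f : (Fin d → ℝ) → EReal) (x : Fin d → ℝ) :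
    EReal :=
  ⨆ y : Fin d → ℝ, (coupling N x y : EReal) - conjugate N f y

/-- `f` is Capra-convex when it equals its Capra biconjugate. -/
def IsCapraConvex {d : ℕ} (N : (Fin d → ℝ) → ℝ) (f : (Fin d → ℝ) → EReal) : Prop :=
  biconjugate N f = f

/-- The Capra-subdifferential of `f` at `x`. -/
def subdifferential {d : ℕ} (N : (Fin d → ℝ) → ℝ) (f : (Fin d → ℝ) → EReal)
    (x : Fin d → ℝ) : Set (Fin d → ℝ) :=
  {y | conjugate N f y = (coupling N x y : EReal) - f x}

/-- The domain of the Capra-subdifferential: the points where `f` is Capra-subdifferentiable. -/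
def subdifferentialDomain {d : ℕ} (N : (Fin d → ℝ) → ℝ) (f : (Fin d → ℝ) → EReal) :
    Set (Fin d → ℝ) :=
  {x | (subdifferential N f x).Nonempty}

/-- The support of a vector. -/
def supp {d : ℕ} (x : Fin d → ℝ) : Finset (Fin d) :=
  open scoped Classical in Finset.univ.filter fun j => x j ≠ 0

/-- The number of nonzero coordinates. -/
def l0 {d : ℕ} (x : Fin d → ℝ) : ℕ := (supp x).card

/-- The `ℓ0` pseudonorm as an extended-real-valued function. -/
def ell0 (d : ℕ) (x : Fin d → ℝ) : EReal := ((l0 x : ℝ) : EReal)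

/-- The vector `x_K`, which agrees with `x` on `K` and vanishes outside `K`. -/
def restrict {d : ℕ} (K : Finset (Fin d)) (x : Fin d → ℝ) : Fin d → ℝ :=
  fun j => if j ∈ K then x j else 0

/-- `ν` orders the coordinates of `y` by nonincreasing absolute value
(`ν 0` is the index of a largest one). -/
def IsDecreasingOrder {d : ℕ} (y : Fin d → ℝ) (ν : Equiv.Perm (Fin d)) : Prop :=
  Antitone fun i => |y (ν i)|

/-- A permutation that orders the coordinates of `y` by nonincreasing absolute value. -/
def decreasingOrder {d : ℕ} (y : Fin d → ℝ) : Equiv.Perm (Fin d) :=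
  Tuple.sort fun i => -|y i|

theorem isDecreasingOrder_decreasingOrder {d : ℕ} (y : Fin d → ℝ) :
    IsDecreasingOrder y (decreasingOrder y) := by
  intro i j hij
  have h := Tuple.monotone_sort (fun i => -|y i|) hij
  simpa [decreasingOrder] using h

/-- The top `(k, q)`-norm: the `ℓ_q` norm of the `k` largest absolute values of `y` when
`1 ≤ q < ∞`, and `‖y‖_∞` when `q = ∞`; it is `0` for `k = 0`. -/
def topNorm {d : ℕ} (k : ℕ) (q : ℝ≥0∞) (y : Fin d → ℝ) : ℝ :=
  open scoped Classical in
  if k = 0 then 0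
  else if q = ∞ then lpNorm ∞ y
  else (∑ i : Fin d with i.val < k, |y (decreasingOrder y i)| ^ q.toReal) ^ (1 / q.toReal)

/-- The top norm may be computed with any decreasing ordering of the coordinates. -/
theorem topNorm_eq {d : ℕ} {k : ℕ} (hk : k ≠ 0) {q : ℝ≥0∞} (hq : q ≠ ∞) {y : Fin d → ℝ}
    {ν : Equiv.Perm (Fin d)} (hν : IsDecreasingOrder y ν) :
    topNorm k q y =
      (∑ i : Fin d with i.val < k, |y (ν i)| ^ q.toReal) ^ (1 / q.toReal) := by
  have h1 : Monotone ((fun i => -|y i|) ∘ ν) := fun i j hij => by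
    simpa using hν hij
  have h2 := Tuple.unique_monotone (Tuple.monotone_sort fun i => -|y i|) h1
  have h3 : ∀ i, |y (decreasingOrder y i)| = |y (ν i)| := fun i => by
    have := congrFun h2 i
    simpa [decreasingOrder] using this
  simp [topNorm, hk, hq, h3]

end

end Capra

open Capra

/-!
The function `c(·, y) - ℓ0` decides everything: `ℓ0` is finite, so `y` is a Capra-subgradient of `ℓ0`
at `x` exactly when `x` maximizes `c(·, y) - ℓ0` (`mem_subdifferential_iff`), and the biconjugate at
`x` equals `ℓ0 x` as soon as such a `y` exists.

Let `q` be the conjugate exponent of `p`. Over the vectors supported in an index set `K`, the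
coupling `c(·, y)` has maximum `‖y_K‖_q`, by the equality case of Hölder's inequality. Hence the
maximum of `c(·, y) - ℓ0` is the maximum of `‖y_K‖_q - |K|` over all `K`
(`IsDualNorm.mem_subdifferential_iff_forall_finset`). For `1 ≤ q < ∞` and `L = supp x`, optimality of
`x` splits into three parts. The vector `x` attains `‖y_L‖_q`, which is the normal cone condition
(`IsDualNorm.mem_normalCone_iff`). The set `L` carries the largest coordinates of `y`, and `|L|`
maximizes `T k - k`, where `T k` is the top norm of `y`
(`forall_lpNorm_restrict_sub_card_le_iff`). The `q`-th powers of `T` have nonincreasing increments and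
`t ↦ (t + 1) ^ q - t ^ q` is nondecreasing, so maximality of `T k - k` can be read off from its
increments (`forall_sub_le_iff_of_rpow_succ`). This covers `1 < p < ∞` and, with `q = 1`, also
`p = ∞`.

For `1 < p < ∞` a subgradient at any `x ≠ 0` is a large multiple of the Hölder dual vector of `x`,
because omitting a coordinate of the support strictly lowers the `ℓ_q` norm of that vector
(`subdifferentialDomain_lpNorm_of_holderConjugate`). For `p = 1` and `p = ∞` the sign vector of `x`
shows that the biconjugate is at least `‖x‖_1 / ‖x‖_p`. Testing the conjugate on a vector with at most
one nonzero coordinate when `p = 1`, and on signs of the coordinates of `y` that exceed one in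
absolute value when `p = ∞`, gives the matching upper bound. If `p = ∞`, each coordinate in the
support of a point `x` of the domain contributes at least one to the coupling with a subgradient, which
forces that coordinate to have absolute value `‖x‖_∞` (`abs_eq_lpNorm_top_of_mem_subdifferential`).
-/

open Capra

namespace Capra

variable {d : ℕ}

/-! ### The `ℓ_p` norms -/

theorem lpNorm_eq_sum {p : ℝ≥0∞} (hp : 0 < p.toReal) (x : Fin d → ℝ) :
    lpNorm p x = (∑ i, |x i| ^ p.toReal) ^ (1 / p.toReal) := by
  simp [lpNorm, PiLp.norm_eq_sum hp]

theorem lpNorm_one (x : Fin d → ℝ) : lpNorm 1 x = ∑ i, |x i| := by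
  simp [lpNorm_eq_sum (p := 1) (by simp)]

theorem lpNorm_nonneg {p : ℝ≥0∞} (hp : 1 ≤ p) (x : Fin d → ℝ) : 0 ≤ lpNorm p x := by
  have : Fact (1 ≤ p) := ⟨hp⟩
  exact norm_nonneg _

theorem lpNorm_zero {p : ℝ≥0∞} (hp : 1 ≤ p) : lpNorm p (0 : Fin d → ℝ) = 0 := by
  have : Fact (1 ≤ p) := ⟨hp⟩
  simp [lpNorm]

theorem lpNorm_pos {p : ℝ≥0∞} (hp : 1 ≤ p) {x : Fin d → ℝ} (hx : x ≠ 0) : 0 < lpNorm p x := by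
  have : Fact (1 ≤ p) := ⟨hp⟩
  simpa [lpNorm] using hx

theorem lpNorm_smul {p : ℝ≥0∞} (hp : 1 ≤ p) (a : ℝ) (x : Fin d → ℝ) :
    lpNorm p (a • x) = |a| * lpNorm p x := by
  have : Fact (1 ≤ p) := ⟨hp⟩
  simp [lpNorm, norm_smul]

theorem abs_apply_le_lpNorm {p : ℝ≥0∞} (hp : 1 ≤ p) (x : Fin d → ℝ) (i : Fin d) :
    |x i| ≤ lpNorm p x := by
  have : Fact (1 ≤ p) := ⟨hp⟩
  exact PiLp.norm_apply_le (WithLp.toLp p x : PiLp p (fun _ : Fin d => ℝ)) i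

theorem lpNorm_top_le_iff {x : Fin d → ℝ} {C : ℝ} (hC : 0 ≤ C) :
    lpNorm ∞ x ≤ C ↔ ∀ i, |x i| ≤ C :=
  ⟨fun h i => (abs_apply_le_lpNorm le_top x i).trans h, fun h => by
    rw [lpNorm, PiLp.norm_eq_ciSup]
    exact Real.iSup_le h hC⟩

/-- The `ℓ_∞` norm of a vector is attained at one of its coordinates. -/
theorem exists_abs_apply_eq_lpNorm_top (hd : 1 ≤ d) (x : Fin d → ℝ) :
    ∃ i, |x i| = lpNorm ∞ x := by
  have : Nonempty (Fin d) := ⟨⟨0, hd⟩⟩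
  obtain ⟨i, hi⟩ := exists_eq_ciSup_of_finite (f := fun i => |x i|)
  exact ⟨i, by rw [lpNorm, PiLp.norm_eq_ciSup]; exact hi⟩

/-! ### Supports and sign vectors -/

theorem mem_supp {x : Fin d → ℝ} {i : Fin d} : i ∈ supp x ↔ x i ≠ 0 := by
  simp [supp]

theorem supp_eq_empty {x : Fin d → ℝ} : supp x = ∅ ↔ x = 0 := by
  simp [Finset.eq_empty_iff_forall_notMem, mem_supp, funext_iff]

theorem l0_zero : l0 (0 : Fin d → ℝ) = 0 := by
  simp [l0, supp_eq_empty.2 rfl]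

theorem l0_pos {x : Fin d → ℝ} (hx : x ≠ 0) : 0 < l0 x := by
  rw [l0, Finset.card_pos, Finset.nonempty_iff_ne_empty]
  exact fun h => hx (supp_eq_empty.1 h)

theorem l0_le (x : Fin d → ℝ) : l0 x ≤ d := by
  simpa [l0] using Finset.card_le_univ (supp x)

theorem supp_restrict_subset (K : Finset (Fin d)) (y : Fin d → ℝ) :
    supp (restrict K y) ⊆ K := by
  intro i hi
  by_contra h
  simp [mem_supp, restrict, h] at hi

/-- Restricting `y` to a set that contains the support of `x` does not change `⟨x, y⟩`. -/
theorem dotProduct_restrict {x : Fin d → ℝ} {K : Finset (Fin d)} (h : supp x ⊆ K)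
    (y : Fin d → ℝ) : x ⬝ᵥ restrict K y = x ⬝ᵥ y := by
  refine Finset.sum_congr rfl fun i _ => ?_
  by_cases hi : i ∈ K
  · simp [restrict, hi]
  · have : x i = 0 := by
      by_contra h0
      exact hi (h (mem_supp.2 h0))
    simp [this]

/-- The vector of signs of the coordinates of `x`. -/
noncomputable def signVec (x : Fin d → ℝ) : Fin d → ℝ := fun i => (SignType.sign (x i) : ℝ)

theorem abs_signVec_le_one (x : Fin d → ℝ) (i : Fin d) : |signVec x i| ≤ 1 := by
  rcases lt_trichotomy (x i) 0 with h | h | h <;> simp [signVec, h]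

theorem dotProduct_signVec (x : Fin d → ℝ) : x ⬝ᵥ signVec x = ∑ i, |x i| := by
  simp [dotProduct, signVec, self_mul_sign]

theorem sum_abs_le_l0_mul {x : Fin d → ℝ} {C : ℝ} (h : ∀ i, |x i| ≤ C) :
    ∑ i, |x i| ≤ l0 x * C := by
  calc ∑ i, |x i| = ∑ i ∈ supp x, |x i| :=
        (Finset.sum_subset (Finset.subset_univ _) fun i _ hi => by
          simpa [mem_supp] using hi).symm
    _ ≤ ∑ i ∈ supp x, C := Finset.sum_le_sum fun i _ => h i
    _ = l0 x * C := by simp [l0]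

/-! ### Dual norms -/

/-- `M` is the dual norm of `N`, recorded by Hölder's inequality together with the fact that the
supremum of `⟨x, y⟩` over the unit ball of `N` is attained, at a vector whose support is contained
in that of `y`. -/
structure IsDualNorm (N M : (Fin d → ℝ) → ℝ) : Prop where
  pos : ∀ x, x ≠ 0 → 0 < N x
  nonneg : ∀ y, 0 ≤ M y
  dotProduct_le : ∀ x y, x ⬝ᵥ y ≤ N x * M y
  exists_attained : ∀ y, ∃ x, N x ≤ 1 ∧ x ⬝ᵥ y = M y ∧ supp x ⊆ supp y

theorem dotProduct_le_lpNorm_one_mul_top (x y : Fin d → ℝ) :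
    x ⬝ᵥ y ≤ lpNorm 1 x * lpNorm ∞ y := by
  rw [lpNorm_one, Finset.sum_mul]
  refine Finset.sum_le_sum fun i _ => ?_
  calc x i * y i ≤ |x i| * |y i| := by rw [← abs_mul]; exact le_abs_self _
    _ ≤ |x i| * lpNorm ∞ y :=
        mul_le_mul_of_nonneg_left (abs_apply_le_lpNorm le_top y i) (abs_nonneg _)

theorem dotProduct_le_lpNorm_mul_lpNorm {p q : ℝ≥0∞} (h : p.toReal.HolderConjugate q.toReal)
    (x y : Fin d → ℝ) : x ⬝ᵥ y ≤ lpNorm p x * lpNorm q y := by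
  rw [lpNorm_eq_sum h.pos, lpNorm_eq_sum h.symm.pos]
  exact Real.inner_le_Lp_mul_Lq _ _ _ h

/-- For `‖y‖_∞`, the supremum over the `ℓ_1` ball is attained at a vector with at most one nonzero
coordinate. -/
theorem exists_attained_one_top (hd : 1 ≤ d) (y : Fin d → ℝ) :
    ∃ x, lpNorm 1 x ≤ 1 ∧ x ⬝ᵥ y = lpNorm ∞ y ∧ supp x ⊆ supp y ∧ l0 x ≤ 1 := by
  obtain ⟨i, hi⟩ := exists_abs_apply_eq_lpNorm_top hd y
  have hs : supp (Pi.single i (signVec y i) : Fin d → ℝ) ⊆ {i} := by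
    intro j hj
    by_contra h
    simp only [Finset.mem_singleton] at h
    simp [mem_supp, h] at hj
  refine ⟨Pi.single i (signVec y i), ?_, ?_, ?_, ?_⟩
  · rw [lpNorm_one, Finset.sum_eq_single i]
    · simpa using abs_signVec_le_one y i
    · intro j _ hj
      simp [hj]
    · simp
  · rw [single_dotProduct, ← hi, signVec, sign_mul_self]
  · intro j hj
    have hji : j = i := by simpa using hs hj
    subst hji
    rw [mem_supp] at hj ⊢
    intro h0
    simp [signVec, h0] at hj
  · simpa [l0] using Finset.card_le_card hs

/-- For `1 ≤ q < ∞`, the supremum of `⟨x, y⟩` over the unit ball of the conjugate norm is attained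
at a vector with the same support as `y`. -/
theorem exists_attained_supp_eq {p q : ℝ≥0∞} (hp : 1 ≤ p) (hq : 1 ≤ q)
    (h : p.toReal.HolderConjugate q.toReal)
    (y : Fin d → ℝ) : ∃ x, lpNorm p x ≤ 1 ∧ x ⬝ᵥ y = lpNorm q y ∧ supp x = supp y := by
  set P := p.toReal with hPdef
  set Q := q.toReal with hQdef
  have hQ : 0 < Q := h.symm.pos
  by_cases hy : y = 0
  · subst hy
    exact ⟨0, by simp [lpNorm_zero hp], by simp [lpNorm_zero hq], rfl⟩
  set S := ∑ i, |y i| ^ Q with hS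
  have hSpos : 0 < S := by
    obtain ⟨i, hi⟩ : ∃ i, y i ≠ 0 := by
      by_contra! h0
      exact hy (funext h0)
    exact Finset.sum_pos' (fun _ _ => by positivity) ⟨i, Finset.mem_univ _, by positivity⟩
  have hSP : 0 < S ^ (1 / P) := by positivity
  refine ⟨fun i => signVec y i * |y i| ^ (Q - 1) / S ^ (1 / P), ?_, ?_, ?_⟩
  · have key : ∀ i, |signVec y i * |y i| ^ (Q - 1) / S ^ (1 / P)| ^ P = |y i| ^ Q / S := by
      intro i
      by_cases hi : y i = 0
      · simp [signVec, hi, Real.zero_rpow h.ne_zero, Real.zero_rpow hQ.ne']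
      · have hs : |signVec y i| = 1 := by
          rcases lt_or_gt_of_ne hi with h | h <;> simp [signVec, h]
        rw [abs_div, abs_mul, hs, one_mul, abs_of_pos hSP,
          abs_of_nonneg (by positivity), Real.div_rpow (by positivity) hSP.le,
          ← Real.rpow_mul hSpos.le, ← Real.rpow_mul (abs_nonneg _), h.symm.sub_one_mul_conj,
          one_div_mul_cancel h.ne_zero, Real.rpow_one]
    rw [lpNorm_eq_sum h.pos]
    simp only [P] at key ⊢
    rw [Finset.sum_congr rfl fun i _ => key i, ← Finset.sum_div, ← hS, div_self hSpos.ne']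
    simp
  · rw [lpNorm_eq_sum hQ]
    have key : ∀ i, signVec y i * |y i| ^ (Q - 1) / S ^ (1 / P) * y i
        = |y i| ^ Q / S ^ (1 / P) := by
      intro i
      by_cases hi : y i = 0
      · simp [hi, Real.zero_rpow hQ.ne']
      · rw [Real.rpow_sub_one (abs_pos.2 hi).ne', signVec]
        have h2 : |y i| ≠ 0 := (abs_pos.2 hi).ne'
        field_simp
        rw [sign_mul_self]
    rw [dotProduct, Finset.sum_congr rfl fun i _ => key i, ← Finset.sum_div, ← hS]
    change S / S ^ (1 / P) = S ^ (1 / Q)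
    have : 1 / Q = 1 - 1 / P := by
      have := h.inv_add_inv_eq_one
      simp only [one_div]; linarith
    rw [this, Real.rpow_sub hSpos, Real.rpow_one]
  · ext i
    rw [mem_supp, mem_supp]
    by_cases hi : y i = 0
    · simp [hi, signVec]
    · have hs : signVec y i ≠ 0 := by
        rcases lt_or_gt_of_ne hi with h | h <;> simp [signVec, h]
      have h1 : |y i| ^ (Q - 1) ≠ 0 := (Real.rpow_pos_of_pos (abs_pos.2 hi) _).ne'
      exact iff_of_true (div_ne_zero (mul_ne_zero hs h1) hSP.ne') hi

theorem isDualNorm_one_top (hd : 1 ≤ d) : IsDualNorm (d := d) (lpNorm 1) (lpNorm ∞) where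
  pos _ := lpNorm_pos le_rfl
  nonneg := lpNorm_nonneg le_top
  dotProduct_le := dotProduct_le_lpNorm_one_mul_top
  exists_attained y := by
    obtain ⟨x, h1, h2, h3, -⟩ := exists_attained_one_top hd y
    exact ⟨x, h1, h2, h3⟩

theorem isDualNorm_top_one : IsDualNorm (d := d) (lpNorm ∞) (lpNorm 1) where
  pos _ := lpNorm_pos le_top
  nonneg := lpNorm_nonneg le_rfl
  dotProduct_le x y := by
    rw [dotProduct_comm, mul_comm]
    exact dotProduct_le_lpNorm_one_mul_top y x
  exists_attained y := by
    refine ⟨signVec y, (lpNorm_top_le_iff zero_le_one).2 (abs_signVec_le_one y), ?_, ?_⟩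
    · rw [dotProduct_comm, dotProduct_signVec, lpNorm_one]
    · intro i hi
      rw [mem_supp] at hi ⊢
      intro h0
      simp [signVec, h0] at hi

theorem isDualNorm_of_holderConjugate {p q : ℝ≥0∞} (hp : 1 ≤ p) (hq : 1 ≤ q)
    (h : p.toReal.HolderConjugate q.toReal) : IsDualNorm (d := d) (lpNorm p) (lpNorm q) where
  pos _ := lpNorm_pos hp
  nonneg := lpNorm_nonneg hq
  dotProduct_le := dotProduct_le_lpNorm_mul_lpNorm h
  exists_attained y := by
    obtain ⟨x, h1, h2, h3⟩ := exists_attained_supp_eq hp hq h y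
    exact ⟨x, h1, h2, h3.subset⟩

/-! ### The Capra conjugate, biconjugate and subdifferential of `ℓ0` -/

section General

variable {N M : (Fin d → ℝ) → ℝ}

@[simp]
theorem coupling_zero (y : Fin d → ℝ) : coupling N 0 y = 0 := by simp [coupling]

theorem coupling_of_ne_zero {x : Fin d → ℝ} (hx : x ≠ 0) (y : Fin d → ℝ) :
    coupling N x y = (x ⬝ᵥ y) / N x := by simp [coupling, hx]

theorem coupling_restrict {x : Fin d → ℝ} {K : Finset (Fin d)} (h : supp x ⊆ K)
    (y : Fin d → ℝ) : coupling N x (restrict K y) = coupling N x y := by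
  simp [coupling, dotProduct_restrict h]

theorem coupling_smul_right (x : Fin d → ℝ) (a : ℝ) (y : Fin d → ℝ) :
    coupling N x (a • y) = a * coupling N x y := by
  by_cases hx : x = 0
  · simp [hx]
  · simp [coupling_of_ne_zero hx, mul_div_assoc]

theorem conjugate_ell0_eq (y : Fin d → ℝ) :
    conjugate N (ell0 d) y = ⨆ x, ((coupling N x y - l0 x : ℝ) : EReal) := by
  simp [conjugate, ell0]

/-- The function `ℓ0` is finite, so a subgradient at `x` is a `y` for which `x` maximizes
`c(·, y) - ℓ0`. -/
theorem mem_subdifferential_iff {x y : Fin d → ℝ} :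
    y ∈ subdifferential N (ell0 d) x ↔
      ∀ x', coupling N x' y - l0 x' ≤ coupling N x y - l0 x := by
  have h : ((coupling N x y : ℝ) : EReal) - ell0 d x
      = ((coupling N x y - l0 x : ℝ) : EReal) := by simp [ell0]
  rw [subdifferential, Set.mem_ofPred_eq, conjugate_ell0_eq, h]
  constructor
  · intro h x'
    rw [← EReal.coe_le_coe_iff, ← h]
    exact le_iSup (fun x' => ((coupling N x' y - l0 x' : ℝ) : EReal)) x'
  · intro h
    exact le_antisymm (iSup_le fun x' => EReal.coe_le_coe_iff.2 (h x'))
      (le_iSup (fun x' => ((coupling N x' y - l0 x' : ℝ) : EReal)) x)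

theorem biconjugate_ell0_le {x : Fin d → ℝ} {v : ℝ}
    (h : ∀ y, ∃ x', coupling N x y - v ≤ coupling N x' y - l0 x') :
    biconjugate N (ell0 d) x ≤ v := by
  refine iSup_le fun y => ?_
  obtain ⟨x', hx'⟩ := h y
  have h1 : ((coupling N x' y - l0 x' : ℝ) : EReal) ≤ conjugate N (ell0 d) y := by
    rw [conjugate_ell0_eq]
    exact le_iSup (fun x' => ((coupling N x' y - l0 x' : ℝ) : EReal)) x'
  refine (EReal.sub_le_sub le_rfl h1).trans ?_
  rw [← EReal.coe_sub, EReal.coe_le_coe_iff]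
  linarith

theorem le_biconjugate_ell0 {y : Fin d → ℝ} {C : ℝ} (x : Fin d → ℝ)
    (h : ∀ x', coupling N x' y - l0 x' ≤ C) :
    ((coupling N x y - C : ℝ) : EReal) ≤ biconjugate N (ell0 d) x := by
  have h1 : conjugate N (ell0 d) y ≤ C := by
    rw [conjugate_ell0_eq]
    exact iSup_le fun x' => EReal.coe_le_coe_iff.2 (h x')
  refine le_trans ?_ (le_iSup _ y)
  rw [EReal.coe_sub]
  exact EReal.sub_le_sub le_rfl h1

/-- Where `ℓ0` is Capra-subdifferentiable, it agrees with its biconjugate. -/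
theorem biconjugate_ell0_eq_of_mem_subdifferential {x y : Fin d → ℝ}
    (h : y ∈ subdifferential N (ell0 d) x) : biconjugate N (ell0 d) x = ell0 d x := by
  refine le_antisymm (biconjugate_ell0_le fun y => ⟨x, le_rfl⟩) ?_
  have := le_biconjugate_ell0 x (mem_subdifferential_iff.1 h)
  rwa [sub_sub_cancel] at this

theorem IsDualNorm.coupling_le (h : IsDualNorm N M) (x y : Fin d → ℝ) :
    coupling N x y ≤ M y := by
  by_cases hx : x = 0
  · simpa [hx] using h.nonneg y
  · rw [coupling_of_ne_zero hx, div_le_iff₀ (h.pos x hx), mul_comm]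
    exact h.dotProduct_le x y

theorem IsDualNorm.le_coupling (h : IsDualNorm N M) {x y : Fin d → ℝ} (hx : N x ≤ 1)
    (hxy : x ⬝ᵥ y = M y) : M y ≤ coupling N x y := by
  by_cases h0 : x = 0
  · simp [← hxy, h0]
  · rw [coupling_of_ne_zero h0, le_div_iff₀ (h.pos x h0), hxy]
    exact mul_le_of_le_one_right (h.nonneg y) hx

/-- At a normalized vector, the normal cone to the unit ball consists of the vectors for which
Hölder's inequality is an equality. -/
theorem IsDualNorm.mem_normalCone_iff (h : IsDualNorm N M) {x : Fin d → ℝ} (hx : x ≠ 0)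
    (y : Fin d → ℝ) :
    y ∈ normalCone {x' | N x' ≤ 1} ((N x)⁻¹ • x) ↔ M y ≤ coupling N x y := by
  have hc : ((N x)⁻¹ • x) ⬝ᵥ y = coupling N x y := by
    rw [coupling_of_ne_zero hx, smul_dotProduct, smul_eq_mul, div_eq_inv_mul]
  simp only [normalCone, Set.mem_ofPred_eq, sub_dotProduct, hc, sub_nonpos]
  constructor
  · intro hy
    obtain ⟨x', h1, h2, -⟩ := h.exists_attained y
    exact h2 ▸ hy x' h1
  · intro hy x' hx'
    exact ((h.dotProduct_le x' y).trans (mul_le_of_le_one_left (h.nonneg y) hx')).trans hy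

/-- The supremum of `c(·, y) - ℓ0` can be computed one candidate support at a time: over the
vectors supported in `K` the coupling has supremum `M (y_K)`. -/
theorem IsDualNorm.mem_subdifferential_iff_forall_finset (h : IsDualNorm N M)
    {x y : Fin d → ℝ} :
    y ∈ subdifferential N (ell0 d) x ↔
      ∀ K : Finset (Fin d), M (restrict K y) - K.card ≤ coupling N x y - l0 x := by
  rw [mem_subdifferential_iff]
  constructor
  · intro hy K
    obtain ⟨x', h1, h2, h3⟩ := h.exists_attained (restrict K y)
    have hK : supp x' ⊆ K := h3.trans (supp_restrict_subset K y)
    have h4 := h.le_coupling h1 h2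
    rw [coupling_restrict hK] at h4
    have h5 : (l0 x' : ℝ) ≤ K.card := by exact_mod_cast Finset.card_le_card hK
    linarith [hy x']
  · intro hy x'
    have h1 := h.coupling_le x' (restrict (supp x') y)
    rw [coupling_restrict subset_rfl] at h1
    have h2 := hy (supp x')
    rw [l0]
    linarith

end General

/-! ### Vectors of the unit `ℓ_∞` ball -/

theorem coupling_le_l0 {p : ℝ≥0∞} (hp : 1 ≤ p) (x : Fin d → ℝ) {y : Fin d → ℝ}
    (hy : ∀ i, |y i| ≤ 1) : coupling (lpNorm p) x y ≤ l0 x := by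
  by_cases hx : x = 0
  · simp [hx]
  rw [coupling_of_ne_zero hx, div_le_iff₀ (lpNorm_pos hp hx)]
  refine le_trans (Finset.sum_le_sum fun i _ => ?_)
    (sum_abs_le_l0_mul (abs_apply_le_lpNorm hp x))
  calc x i * y i ≤ |x i| * |y i| := by rw [← abs_mul]; exact le_abs_self _
    _ ≤ |x i| := mul_le_of_le_one_right (abs_nonneg _) (hy i)

theorem coupling_signVec {p : ℝ≥0∞} {x : Fin d → ℝ} (hx : x ≠ 0) :
    coupling (lpNorm p) x (signVec x) = lpNorm 1 x / lpNorm p x := by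
  rw [coupling_of_ne_zero hx, dotProduct_signVec, lpNorm_one]

theorem subdifferential_ell0_zero {p : ℝ≥0∞} (hp : 1 ≤ p) :
    subdifferential (lpNorm p) (ell0 d) 0 = lpBall d ∞ := by
  ext y
  rw [mem_subdifferential_iff, lpBall, Set.mem_ofPred_eq, lpNorm_top_le_iff zero_le_one]
  simp only [coupling_zero, l0_zero, Nat.cast_zero, sub_zero, sub_nonpos]
  refine ⟨fun h i => ?_, fun h x => coupling_le_l0 hp x h⟩
  -- A vector supported on the single coordinate `i` already forces `|y i| ≤ 1`.
  have hs : ∀ a : ℝ, a ≠ 0 → l0 (Pi.single i a : Fin d → ℝ) = 1 := by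
    intro a ha
    rw [l0, Finset.card_eq_one]
    refine ⟨i, ?_⟩
    ext j
    by_cases hj : j = i
    · subst hj; simp [mem_supp, ha]
    · simp [mem_supp, hj]
  have hn : ∀ a : ℝ, |a| = 1 → lpNorm p (Pi.single i a : Fin d → ℝ) = 1 := by
    intro a ha
    have : Fact (1 ≤ p) := ⟨hp⟩
    simp [lpNorm, ha]
  have key : ∀ a : ℝ, |a| = 1 → a * y i ≤ 1 := by
    intro a ha
    have ha0 : a ≠ 0 := by rintro rfl; simp at ha
    have h1 := h (Pi.single i a)
    rw [coupling_of_ne_zero (by simpa using ha0), hs a ha0, hn a ha, single_dotProduct] at h1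
    simpa using h1
  rw [abs_le]
  have h1 := key 1 (by simp)
  have h2 := key (-1) (by simp)
  constructor <;> linarith

theorem biconjugate_ell0_zero {p : ℝ≥0∞} (hp : 1 ≤ p) :
    biconjugate (lpNorm p) (ell0 d) 0 = 0 := by
  have h : (0 : Fin d → ℝ) ∈ subdifferential (lpNorm p) (ell0 d) 0 := by
    rw [subdifferential_ell0_zero hp, lpBall, Set.mem_ofPred_eq, lpNorm_zero le_top]
    exact zero_le_one
  rw [biconjugate_ell0_eq_of_mem_subdifferential h]
  simp [ell0, l0_zero]

theorem le_biconjugate_ell0_of_ne_zero {p : ℝ≥0∞} (hp : 1 ≤ p) {x : Fin d → ℝ} (hx : x ≠ 0) :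
    ((lpNorm 1 x / lpNorm p x : ℝ) : EReal) ≤ biconjugate (lpNorm p) (ell0 d) x := by
  have := le_biconjugate_ell0 (N := lpNorm p) (C := 0) x fun x' =>
    sub_nonpos.2 (coupling_le_l0 hp x' (abs_signVec_le_one x))
  rwa [sub_zero, coupling_signVec hx] at this

theorem signVec_mem_subdifferential {p : ℝ≥0∞} (hp : 1 ≤ p) {x : Fin d → ℝ} (hx : x ≠ 0)
    (h : lpNorm 1 x / lpNorm p x = l0 x) :
    signVec x ∈ subdifferential (lpNorm p) (ell0 d) x := by
  rw [mem_subdifferential_iff, coupling_signVec hx, h, sub_self]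
  exact fun x' => sub_nonpos.2 (coupling_le_l0 hp x' (abs_signVec_le_one x))

/-! ### The source norm `ℓ_1` -/

theorem biconjugate_ell0_lpNorm_one (hd : 1 ≤ d) {x : Fin d → ℝ} (hx : x ≠ 0) :
    biconjugate (lpNorm 1) (ell0 d) x = 1 := by
  refine le_antisymm ?_ ?_
  · refine biconjugate_ell0_le (v := 1) fun y => ?_
    obtain ⟨x', h1, h2, -, h4⟩ := exists_attained_one_top hd y
    refine ⟨x', ?_⟩
    have h3 := (isDualNorm_one_top hd).le_coupling h1 h2
    have h5 := (isDualNorm_one_top hd).coupling_le x y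
    have h6 : (l0 x' : ℝ) ≤ 1 := by exact_mod_cast h4
    linarith
  · have := le_biconjugate_ell0_of_ne_zero le_rfl hx
    rwa [div_self (lpNorm_pos le_rfl hx).ne'] at this

theorem subdifferentialDomain_lpNorm_one (hd : 1 ≤ d) :
    subdifferentialDomain (lpNorm 1) (ell0 d) = {x | l0 x ≤ 1} := by
  ext x
  rw [subdifferentialDomain, Set.mem_ofPred_eq, Set.mem_ofPred_eq]
  by_cases hx : x = 0
  · subst hx
    refine ⟨fun _ => by simp [l0_zero], fun _ => ⟨0, ?_⟩⟩
    rw [subdifferential_ell0_zero le_rfl, lpBall, Set.mem_ofPred_eq, lpNorm_zero le_top]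
    exact zero_le_one
  constructor
  · rintro ⟨y, hy⟩
    have h1 := biconjugate_ell0_eq_of_mem_subdifferential hy
    rw [biconjugate_ell0_lpNorm_one hd hx, ell0] at h1
    have h2 : (1 : ℝ) = l0 x := by exact_mod_cast h1
    exact_mod_cast h2.ge
  · intro h
    refine ⟨signVec x, signVec_mem_subdifferential le_rfl hx ?_⟩
    rw [div_self (lpNorm_pos le_rfl hx).ne', le_antisymm h (l0_pos hx), Nat.cast_one]

theorem subdifferential_lpNorm_one (hd : 1 ≤ d) {x : Fin d → ℝ} (hx : l0 x = 1) :
    subdifferential (lpNorm 1) (ell0 d) x =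
      normalCone (lpBall d 1) ((lpNorm 1 x)⁻¹ • x) ∩ {y | 1 ≤ lpNorm ∞ y} := by
  have h0 : x ≠ 0 := by
    rintro rfl
    simp [l0_zero] at hx
  have hdual := isDualNorm_one_top hd
  ext y
  rw [Set.mem_inter_iff, lpBall, hdual.mem_normalCone_iff h0, mem_subdifferential_iff, hx,
    Set.mem_ofPred_eq, Nat.cast_one]
  constructor
  · intro h
    obtain ⟨x', h1, h2, -, h4⟩ := exists_attained_one_top hd y
    have h3 := hdual.le_coupling h1 h2
    have h5 := hdual.coupling_le x y
    have h6 : (l0 x' : ℝ) ≤ 1 := by exact_mod_cast h4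
    have h7 := h 0
    rw [coupling_zero, l0_zero] at h7
    push_cast at h7
    exact ⟨by linarith [h x'], by linarith⟩
  · rintro ⟨h1, h2⟩ x'
    by_cases hx' : x' = 0
    · subst hx'
      rw [coupling_zero, l0_zero]
      push_cast
      linarith
    · have h3 : (1 : ℝ) ≤ l0 x' := by exact_mod_cast l0_pos hx'
      linarith [hdual.coupling_le x' y]

theorem not_isCapraConvex_lpNorm_one (hd : 2 ≤ d) :
    ¬ IsCapraConvex (lpNorm 1) (ell0 d) := by
  intro h
  have hx : (1 : Fin d → ℝ) ≠ 0 := fun h => one_ne_zero (congrFun h ⟨0, by omega⟩)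
  have h1 := congrFun h 1
  rw [biconjugate_ell0_lpNorm_one (by omega) hx, ell0] at h1
  have h2 : (1 : ℝ) = l0 (1 : Fin d → ℝ) := by exact_mod_cast h1
  have h3 : l0 (1 : Fin d → ℝ) = d := by simp [l0, supp]
  rw [h3] at h2
  have h4 : 1 = d := by exact_mod_cast h2
  omega

/-! ### Top norms and rearrangement -/

/-- A set of indices that carries the largest values of `a` maximizes the sum of `a` among all sets
of the same cardinality. -/
theorem sum_le_sum_of_forall_le {ι : Type*} [DecidableEq ι] {a : ι → ℝ} {K L : Finset ι}
    (hcard : K.card = L.card) (h : ∀ j ∉ L, ∀ i ∈ L, a j ≤ a i) :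
    ∑ i ∈ K, a i ≤ ∑ i ∈ L, a i := by
  have hc : (K \ L).card = (L \ K).card := by
    have h1 := Finset.card_sdiff_add_card_inter K L
    have h2 := Finset.card_sdiff_add_card_inter L K
    rw [Finset.inter_comm] at h2
    omega
  have hd : ∑ i ∈ K \ L, a i ≤ ∑ i ∈ L \ K, a i := by
    rcases (L \ K).eq_empty_or_nonempty with h0 | h0
    · rw [h0, Finset.card_empty, Finset.card_eq_zero] at hc
      rw [h0, hc]
    · obtain ⟨m, hm, hmin⟩ := Finset.exists_min_image (L \ K) a h0
      calc ∑ i ∈ K \ L, a i ≤ (K \ L).card • a m :=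
            Finset.sum_le_card_nsmul _ _ _ fun j hj =>
              h j (Finset.mem_sdiff.1 hj).2 m (Finset.mem_sdiff.1 hm).1
        _ = (L \ K).card • a m := by rw [hc]
        _ ≤ ∑ i ∈ L \ K, a i := Finset.card_nsmul_le_sum _ _ _ hmin
  rw [← Finset.sum_inter_add_sum_sdiff K L, ← Finset.sum_inter_add_sum_sdiff L K,
    Finset.inter_comm L K]
  linarith

theorem forall_le_of_sum_le_sum {ι : Type*} [DecidableEq ι] {a : ι → ℝ} {L : Finset ι}
    (h : ∀ K : Finset ι, K.card = L.card → ∑ i ∈ K, a i ≤ ∑ i ∈ L, a i) :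
    ∀ j ∉ L, ∀ i ∈ L, a j ≤ a i := by
  intro j hj i hi
  have hj' : j ∉ L.erase i := fun h => hj (Finset.mem_of_mem_erase h)
  have h1 := h (insert j (L.erase i)) (by
    rw [Finset.card_insert_of_notMem hj', Finset.card_erase_add_one hi])
  rw [Finset.sum_insert hj', ← Finset.add_sum_erase L a hi] at h1
  linarith

theorem lpNorm_restrict {q : ℝ≥0∞} (hq : 0 < q.toReal) (K : Finset (Fin d)) (y : Fin d → ℝ) :
    lpNorm q (restrict K y) = (∑ i ∈ K, |y i| ^ q.toReal) ^ (1 / q.toReal) := by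
  rw [lpNorm_eq_sum hq]
  congr 1
  rw [← Finset.sum_subset (Finset.subset_univ K)]
  · exact Finset.sum_congr rfl fun i hi => by simp [restrict, hi]
  · intro i _ hi
    simp [restrict, hi, Real.zero_rpow hq.ne']

theorem lpNorm_restrict_le_iff {q : ℝ≥0∞} (hq : 0 < q.toReal) {K L : Finset (Fin d)}
    {y : Fin d → ℝ} :
    lpNorm q (restrict K y) ≤ lpNorm q (restrict L y) ↔
      ∑ i ∈ K, |y i| ^ q.toReal ≤ ∑ i ∈ L, |y i| ^ q.toReal := by
  rw [lpNorm_restrict hq, lpNorm_restrict hq]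
  exact Real.rpow_le_rpow_iff (Finset.sum_nonneg fun _ _ => by positivity)
    (Finset.sum_nonneg fun _ _ => by positivity) (by positivity)

theorem lpNorm_restrict_le_of_forall_le {q : ℝ≥0∞} (hq : 0 < q.toReal) {K L : Finset (Fin d)}
    {y : Fin d → ℝ} (hcard : K.card = L.card) (h : ∀ j ∉ L, ∀ i ∈ L, |y j| ≤ |y i|) :
    lpNorm q (restrict K y) ≤ lpNorm q (restrict L y) :=
  (lpNorm_restrict_le_iff hq).2 <| sum_le_sum_of_forall_le hcard fun j hj i hi =>
    Real.rpow_le_rpow (abs_nonneg _) (h j hj i hi) hq.le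

/-- The indices of the `k` first coordinates in the order `ν`. -/
def firstIndices (ν : Equiv.Perm (Fin d)) (k : ℕ) : Finset (Fin d) :=
  (Finset.univ.filter fun i : Fin d => i.val < k).map ν.toEmbedding

theorem card_firstIndices (ν : Equiv.Perm (Fin d)) {k : ℕ} (hk : k ≤ d) :
    (firstIndices ν k).card = k := by
  rw [firstIndices, Finset.card_map, Fin.card_filter_val_lt, min_eq_right hk]

theorem forall_le_firstIndices {y : Fin d → ℝ} {ν : Equiv.Perm (Fin d)}
    (hν : IsDecreasingOrder y ν) (k : ℕ) :
    ∀ j ∉ firstIndices ν k, ∀ i ∈ firstIndices ν k, |y j| ≤ |y i| := by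
  intro j hj i hi
  obtain ⟨j, rfl⟩ := ν.surjective j
  obtain ⟨i, rfl⟩ := ν.surjective i
  simp only [firstIndices, Finset.mem_map_equiv, Equiv.symm_apply_apply, Finset.mem_filter,
    Finset.mem_univ, true_and, not_lt] at hi hj
  exact hν (Fin.le_def.2 (hi.le.trans hj))

theorem topNorm_eq_lpNorm_restrict {q : ℝ≥0∞} (hq0 : 1 ≤ q) (hq : q ≠ ∞) {y : Fin d → ℝ}
    {ν : Equiv.Perm (Fin d)} (hν : IsDecreasingOrder y ν) (k : ℕ) :
    topNorm k q y = lpNorm q (restrict (firstIndices ν k) y) := by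
  by_cases hk : k = 0
  · subst hk
    have : restrict (firstIndices ν 0) y = 0 := by
      ext i
      simp [restrict, firstIndices]
    rw [this, lpNorm_zero hq0, topNorm, if_pos rfl]
  · rw [topNorm_eq hk hq hν, lpNorm_restrict (ENNReal.toReal_pos (by positivity) hq)]
    simp [firstIndices]

theorem topNorm_nonneg {q : ℝ≥0∞} (hq0 : 1 ≤ q) (hq : q ≠ ∞) (y : Fin d → ℝ) (k : ℕ) :
    0 ≤ topNorm k q y := by
  rw [topNorm_eq_lpNorm_restrict hq0 hq (isDecreasingOrder_decreasingOrder y)]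
  exact lpNorm_nonneg hq0 _

theorem topNorm_succ_rpow {q : ℝ≥0∞} (hq0 : 1 ≤ q) (hq : q ≠ ∞) {y : Fin d → ℝ}
    {ν : Equiv.Perm (Fin d)} (hν : IsDecreasingOrder y ν) (k : Fin d) :
    topNorm (k + 1) q y ^ q.toReal = topNorm k q y ^ q.toReal + |y (ν k)| ^ q.toReal := by
  have hqpos : 0 < q.toReal := ENNReal.toReal_pos (by positivity) hq
  have hS : ∀ K : Finset (Fin d), (lpNorm q (restrict K y)) ^ q.toReal =
      ∑ i ∈ K, |y i| ^ q.toReal := by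
    intro K
    rw [lpNorm_restrict hqpos, ← Real.rpow_mul (Finset.sum_nonneg fun _ _ => by positivity),
      one_div_mul_cancel hqpos.ne', Real.rpow_one]
  have hins : firstIndices ν (k + 1) = insert (ν k) (firstIndices ν k) := by
    ext j
    obtain ⟨j, rfl⟩ := ν.surjective j
    simp only [firstIndices, Finset.mem_map_equiv, Equiv.symm_apply_apply, Finset.mem_filter,
      Finset.mem_univ, true_and, Finset.mem_insert, EmbeddingLike.apply_eq_iff_eq, Fin.ext_iff]
    omega
  rw [topNorm_eq_lpNorm_restrict hq0 hq hν, topNorm_eq_lpNorm_restrict hq0 hq hν, hS, hS, hins,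
    Finset.sum_insert (by simp [firstIndices]), add_comm]

/-- The maximization of `‖y_K‖_q - |K|` over all index sets splits into a choice of a set of largest
coordinates and a one-dimensional maximization over the cardinality. -/
theorem forall_lpNorm_restrict_sub_card_le_iff {q : ℝ≥0∞} (hq0 : 1 ≤ q) (hq : q ≠ ∞)
    {y : Fin d → ℝ} (L : Finset (Fin d)) :
    (∀ K : Finset (Fin d),
      lpNorm q (restrict K y) - K.card ≤ lpNorm q (restrict L y) - L.card) ↔
      (∀ j ∉ L, ∀ i ∈ L, |y j| ≤ |y i|) ∧
        ∀ k ≤ d, topNorm k q y - k ≤ topNorm L.card q y - L.card := by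
  have hqpos : 0 < q.toReal := ENNReal.toReal_pos (by positivity) hq
  have hν := isDecreasingOrder_decreasingOrder y
  set ν := decreasingOrder y
  have hcard : ∀ K : Finset (Fin d), (firstIndices ν K.card).card = K.card := fun K =>
    card_firstIndices ν (by simpa using Finset.card_le_univ K)
  have hle : ∀ K : Finset (Fin d), lpNorm q (restrict K y) ≤ topNorm K.card q y := by
    intro K
    rw [topNorm_eq_lpNorm_restrict hq0 hq hν]
    exact lpNorm_restrict_le_of_forall_le hqpos (hcard K).symm (forall_le_firstIndices hν _)
  have hL : (∀ j ∉ L, ∀ i ∈ L, |y j| ≤ |y i|) →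
      topNorm L.card q y = lpNorm q (restrict L y) := by
    intro h
    refine le_antisymm ?_ (hle L)
    rw [topNorm_eq_lpNorm_restrict hq0 hq hν]
    exact lpNorm_restrict_le_of_forall_le hqpos (hcard L) h
  constructor
  · intro h
    have hdom : ∀ j ∉ L, ∀ i ∈ L, |y j| ≤ |y i| := by
      have h1 := forall_le_of_sum_le_sum (a := fun i => |y i| ^ q.toReal) (L := L) fun K hK => by
        have := h K
        rw [hK] at this
        exact (lpNorm_restrict_le_iff hqpos).1 (by linarith)
      exact fun j hj i hi =>
        (Real.rpow_le_rpow_iff (abs_nonneg _) (abs_nonneg _) hqpos).1 (h1 j hj i hi)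
    refine ⟨hdom, fun k hk => ?_⟩
    have h1 := h (firstIndices ν k)
    rwa [card_firstIndices ν hk, ← topNorm_eq_lpNorm_restrict hq0 hq hν, ← hL hdom] at h1
  · rintro ⟨hdom, h⟩ K
    have h1 := h K.card (by simpa using Finset.card_le_univ K)
    rw [hL hdom] at h1
    linarith [hle K]

/-! ### Increments of the top norms -/

/-- For `q ≥ 1`, the increments over unit steps of `t ↦ t ^ q` are nondecreasing, by convexity. -/
theorem add_one_rpow_sub_rpow_mono {q s t : ℝ} (hq : 1 ≤ q) (hs : 0 ≤ s) (hst : s ≤ t) :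
    (s + 1) ^ q - s ^ q ≤ (t + 1) ^ q - t ^ q := by
  have hconv := convexOn_rpow hq
  -- `s + 1` and `t` are the convex combinations of `s` and `t + 1` with exchanged weights.
  have hpos : 0 < t - s + 1 := by linarith
  set θ := 1 / (t - s + 1) with hθ
  have hθ1 : θ * (t - s + 1) = 1 := by rw [hθ]; field_simp
  have hθ0 : 0 ≤ θ := by positivity
  have hθ2 : 0 ≤ 1 - θ := by
    have : θ ≤ 1 := by rw [hθ, div_le_one hpos]; linarith
    linarith
  have hs' : s ∈ Set.Ici (0 : ℝ) := hs
  have ht' : t + 1 ∈ Set.Ici (0 : ℝ) := by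
    rw [Set.mem_Ici]; linarith
  have h1 := hconv.2 hs' ht' hθ2 hθ0 (by ring)
  have h2 := hconv.2 hs' ht' hθ0 hθ2 (by ring)
  simp only [smul_eq_mul] at h1 h2
  have e1 : (1 - θ) * s + θ * (t + 1) = s + 1 := by linear_combination hθ1
  have e2 : θ * s + (1 - θ) * (t + 1) = t := by linear_combination -hθ1
  rw [e1] at h1
  rw [e2] at h2
  linarith

/-- Let `T` be a nonnegative sequence whose `q`-th powers have nonincreasing increments `a`. Then
`T k - k` increases up to some index and decreases afterwards, so whether `l` maximizes it can be
read off from the increments. -/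
theorem forall_sub_le_iff_of_rpow_succ {q : ℝ} (hq : 1 ≤ q) {T : ℕ → ℝ} {a : Fin d → ℝ}
    (hT : ∀ k, 0 ≤ T k) (ha : Antitone a) (ha0 : ∀ k, 0 ≤ a k)
    (hTa : ∀ k : Fin d, T (k + 1) ^ q = T k ^ q + a k) {l : ℕ} (hl : l ≤ d) :
    (∀ k ≤ d, T k - k ≤ T l - l) ↔
      (∀ k : Fin d, k.val < l → a k ≥ (T k + 1) ^ q - T k ^ q) ∧
        ∀ h : l < d, a ⟨l, h⟩ ≤ (T l + 1) ^ q - T l ^ q := by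
  have hq0 : 0 < q := by linarith
  have hup : ∀ k : Fin d, T k + 1 ≤ T (k + 1) ↔ (T k + 1) ^ q - T k ^ q ≤ a k := by
    intro k
    rw [← Real.rpow_le_rpow_iff (by linarith [hT k]) (hT _) hq0, hTa, sub_le_iff_le_add']
  have hdown : ∀ k : Fin d, T (k + 1) ≤ T k + 1 ↔ a k ≤ (T k + 1) ^ q - T k ^ q := by
    intro k
    rw [← Real.rpow_le_rpow_iff (hT _) (by linarith [hT k]) hq0, hTa, le_sub_iff_add_le']
  have hmono1 : ∀ k : Fin d, T k ≤ T (k + 1) := by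
    intro k
    rw [← Real.rpow_le_rpow_iff (hT _) (hT _) hq0, hTa]
    linarith [ha0 k]
  have hmono : ∀ i j : ℕ, i ≤ j → j ≤ d → T i ≤ T j := by
    intro i j hij
    induction j, hij using Nat.le_induction with
    | base => exact fun _ => le_rfl
    | succ j _ ih => exact fun hj => (ih (by omega)).trans (hmono1 ⟨j, hj⟩)
  constructor
  · intro h
    constructor
    · intro k hk
      -- Compare with the last increment before `l`, which is at least one.
      obtain ⟨m, rfl⟩ : ∃ m, l = m + 1 := ⟨l - 1, by omega⟩
      have h1 := h m (by omega)
      push_cast at h1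
      have h2 := (hup ⟨m, hl⟩).1 (by simp only; linarith)
      have h3 : a ⟨m, hl⟩ ≤ a k := ha (Fin.le_def.2 (by simp only; omega))
      have h4 := add_one_rpow_sub_rpow_mono hq (hT k) (hmono k m (by omega) (by omega))
      simp only at h2
      linarith
    · intro hld
      refine (hdown ⟨l, hld⟩).1 ?_
      have h1 := h (l + 1) hld
      push_cast at h1
      simp only
      linarith
  · rintro ⟨h1, h2⟩ k hk
    rcases le_total k l with hkl | hkl
    · clear h2
      induction l, hkl using Nat.le_induction with
      | base => exact le_rfl
      | succ l hkl ih =>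
        have h3 := ih (by omega) fun k hk => h1 k (by omega)
        have h4 := (hup ⟨l, hl⟩).2 (h1 ⟨l, hl⟩ (by simp))
        simp only at h4
        push_cast
        linarith
    · induction k, hkl using Nat.le_induction with
      | base => exact le_rfl
      | succ k hkl ih =>
        have h3 := ih (by omega)
        have hld : l < d := by omega
        have h4 : a ⟨k, hk⟩ ≤ a ⟨l, hld⟩ := ha (Fin.le_def.2 hkl)
        have h5 := add_one_rpow_sub_rpow_mono hq (hT l) (hmono l k hkl (by omega))
        have h6 := (hdown ⟨k, hk⟩).2 (by simp only; linarith [h2 hld])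
        simp only at h6
        push_cast
        linarith

/-- The subgradients of `ℓ0` at a nonzero vector, for a source norm whose dual norm is an `ℓ_q` norm
with `1 ≤ q < ∞`. -/
theorem mem_subdifferential_iff_topNorm {p q : ℝ≥0∞}
    (hdual : IsDualNorm (d := d) (lpNorm p) (lpNorm q)) (hq0 : 1 ≤ q) (hq : q ≠ ∞)
    {x : Fin d → ℝ} (hx : x ≠ 0) {y : Fin d → ℝ} {ν : Equiv.Perm (Fin d)}
    (hν : IsDecreasingOrder y ν) :
    y ∈ subdifferential (lpNorm p) (ell0 d) x ↔
      restrict (supp x) y ∈ normalCone (lpBall d p) ((lpNorm p x)⁻¹ • x) ∧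
      (∀ j ∉ supp x, ∀ i ∈ supp x, |y j| ≤ |y i|) ∧
      (∀ k : Fin d, k.val < l0 x →
        |y (ν k)| ^ q.toReal ≥
          (topNorm k.val q y + 1) ^ q.toReal - (topNorm k.val q y) ^ q.toReal) ∧
      (∀ h : l0 x < d,
        |y (ν ⟨l0 x, h⟩)| ^ q.toReal ≤
          (topNorm (l0 x) q y + 1) ^ q.toReal - (topNorm (l0 x) q y) ^ q.toReal) := by
  have hq1 : 1 ≤ q.toReal := by
    simpa using ENNReal.toReal_mono hq hq0
  rw [← forall_sub_le_iff_of_rpow_succ (T := fun k => topNorm k q y)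
      (a := fun k => |y (ν k)| ^ q.toReal) hq1 (topNorm_nonneg hq0 hq y)
      (fun i j hij => Real.rpow_le_rpow (abs_nonneg _) (hν hij) (by linarith))
      (fun k => by positivity) (topNorm_succ_rpow hq0 hq hν) (l0_le x),
    lpBall, hdual.mem_normalCone_iff hx, coupling_restrict subset_rfl, l0,
    ← forall_lpNorm_restrict_sub_card_le_iff hq0 hq,
    hdual.mem_subdifferential_iff_forall_finset]
  have hle := hdual.coupling_le x (restrict (supp x) y)
  rw [coupling_restrict subset_rfl] at hle
  have hl : (l0 x : ℝ) = (supp x).card := rfl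
  constructor
  · intro h
    have h1 := h (supp x)
    exact ⟨by linarith, fun K => by linarith [h K]⟩
  · rintro ⟨h1, h2⟩ K
    linarith [h2 K]

/-! ### The source norms `ℓ_p` with `1 < p < ∞` -/

theorem toReal_holderConjugate {p q : ℝ≥0∞} (hp : 1 < p) (hp' : p < ∞)
    (h : 1 / p + 1 / q = 1) : p.toReal.HolderConjugate q.toReal := by
  rw [Real.holderConjugate_iff]
  have hq : q ≠ 0 := by
    rintro rfl
    simp at h
  refine ⟨by simpa using (ENNReal.toReal_lt_toReal ENNReal.one_ne_top hp'.ne).2 hp, ?_⟩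
  have h1 := congrArg ENNReal.toReal h
  rw [ENNReal.toReal_add (by simpa using (zero_lt_one.trans hp).ne') (by simpa using hq)] at h1
  simpa using h1

/-- The subgradients of `ℓ0` at `x ≠ 0` are found among the multiples of a dual vector `y` of `x`.
An index set `K` that misses part of the support of `x` satisfies `‖y_K‖_q < 1 = c(x, y)`, and a
large enough multiple of this gap outweighs any difference in cardinality. -/
theorem subdifferentialDomain_lpNorm_of_holderConjugate {p q : ℝ≥0∞} (hp : 1 ≤ p) (hq : 1 ≤ q)
    (h : p.toReal.HolderConjugate q.toReal) :
    subdifferentialDomain (lpNorm p) (ell0 d) = Set.univ := by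
  refine Set.eq_univ_of_forall fun x => ?_
  rw [subdifferentialDomain, Set.mem_ofPred_eq]
  by_cases hx : x = 0
  · subst hx
    refine ⟨0, ?_⟩
    rw [subdifferential_ell0_zero hp, lpBall, Set.mem_ofPred_eq, lpNorm_zero le_top]
    exact zero_le_one
  have hdual := isDualNorm_of_holderConjugate (d := d) hp hq h
  obtain ⟨y, hy1, hy2, hy3⟩ := exists_attained_supp_eq hq hp h.symm x
  have hc : coupling (lpNorm p) x y = 1 := by
    rw [coupling_of_ne_zero hx, dotProduct_comm, hy2, div_self (lpNorm_pos hp hx).ne']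
  have hself : restrict (supp x) y = y := by
    ext i
    rw [restrict, ite_eq_left_iff, ← hy3, mem_supp, not_not]
    exact Eq.symm
  have hle : ∀ K : Finset (Fin d), lpNorm q (restrict K y) ≤ lpNorm q y := by
    intro K
    conv_rhs => rw [← hself]
    rw [lpNorm_restrict_le_iff h.symm.pos]
    calc ∑ i ∈ K, |y i| ^ q.toReal ≤ ∑ i, |y i| ^ q.toReal :=
          Finset.sum_le_sum_of_subset_of_nonneg (Finset.subset_univ _)
            fun _ _ _ => by positivity
      _ = ∑ i ∈ supp x, |y i| ^ q.toReal := by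
          refine (Finset.sum_subset (Finset.subset_univ _) fun i _ hi => ?_).symm
          rw [← hy3, mem_supp, not_not] at hi
          simp [hi, Real.zero_rpow h.symm.ne_zero]
  have hlt : ∀ K : Finset (Fin d), ¬ supp x ⊆ K → lpNorm q (restrict K y) < 1 := by
    intro K hK
    obtain ⟨i, hi, hiK⟩ := Finset.not_subset.1 hK
    refine lt_of_lt_of_le (not_le.1 fun hcon => ?_) hy1
    have hcon' : lpNorm q (restrict Finset.univ y) ≤ lpNorm q (restrict K y) := (hle _).trans hcon
    rw [lpNorm_restrict_le_iff h.symm.pos] at hcon'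
    refine absurd hcon' (not_le.2 (Finset.sum_lt_sum_of_subset (Finset.subset_univ K)
      (Finset.mem_univ i) hiK ?_ fun _ _ _ => by positivity))
    rw [← hy3, mem_supp] at hi
    positivity
  have hev : ∀ᶠ t : ℝ in Filter.atTop, 0 ≤ t ∧ ∀ K : Finset (Fin d), ¬ supp x ⊆ K →
      (l0 x : ℝ) ≤ t * (1 - lpNorm q (restrict K y)) := by
    refine (Filter.eventually_ge_atTop 0).and (Filter.eventually_all.2 fun K => ?_)
    by_cases hK : supp x ⊆ K
    · exact Filter.Eventually.of_forall fun _ h => absurd hK h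
    · filter_upwards [(Filter.tendsto_id.atTop_mul_const
        (sub_pos.2 (hlt K hK))).eventually_ge_atTop (l0 x : ℝ)] with t ht _ using ht
  obtain ⟨t, ht0, ht⟩ := hev.exists
  refine ⟨t • y, hdual.mem_subdifferential_iff_forall_finset.2 fun K => ?_⟩
  have hsmul : restrict K (t • y) = t • restrict K y := by
    ext i
    simp [restrict]
  rw [hsmul, lpNorm_smul hq, abs_of_nonneg ht0, coupling_smul_right, hc]
  by_cases hK : supp x ⊆ K
  · have h1 : (l0 x : ℝ) ≤ K.card := by exact_mod_cast Finset.card_le_card hK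
    have h2 : t * lpNorm q (restrict K y) ≤ t * 1 :=
      mul_le_mul_of_nonneg_left ((hle K).trans hy1) ht0
    linarith
  · have h1 := ht K hK
    have h2 : (0 : ℝ) ≤ K.card := Nat.cast_nonneg _
    linarith

/-! ### The source norm `ℓ_∞` -/

/-- The upper bound compares `y` with its signs on the coordinates where `|y i| > 1`, since
`u * t ≤ u + max (t - 1) 0` for `0 ≤ u ≤ 1`. -/
theorem biconjugate_ell0_lpNorm_top {x : Fin d → ℝ} (hx : x ≠ 0) :
    biconjugate (lpNorm ∞) (ell0 d) x = ((lpNorm 1 x / lpNorm ∞ x : ℝ) : EReal) := by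
  refine le_antisymm (biconjugate_ell0_le fun y => ?_) (le_biconjugate_ell0_of_ne_zero le_top hx)
  have hN := lpNorm_pos le_top hx
  have hdual := isDualNorm_top_one (d := d)
  set K : Finset (Fin d) := Finset.univ.filter fun i => 1 < |y i|
  obtain ⟨x', h1, h2, h3⟩ := hdual.exists_attained (restrict K y)
  have hK : supp x' ⊆ K := h3.trans (supp_restrict_subset K y)
  have h4 := hdual.le_coupling h1 h2
  rw [coupling_restrict hK, lpNorm_restrict (by simp)] at h4
  simp only [ENNReal.toReal_one, Real.rpow_one, div_one] at h4
  have h5 : (l0 x' : ℝ) ≤ K.card := by exact_mod_cast Finset.card_le_card hK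
  have h6 : ∑ i ∈ K, |y i| - K.card = ∑ i, if 1 < |y i| then |y i| - 1 else 0 := by
    rw [← Finset.sum_filter, Finset.sum_sub_distrib]
    simp [K]
  have h7 : coupling (lpNorm ∞) x y - lpNorm 1 x / lpNorm ∞ x
      ≤ ∑ i, if 1 < |y i| then |y i| - 1 else 0 := by
    rw [coupling_of_ne_zero hx, lpNorm_one, dotProduct, Finset.sum_div, Finset.sum_div,
      ← Finset.sum_sub_distrib]
    refine Finset.sum_le_sum fun i _ => ?_
    rw [← sub_div, div_le_iff₀ hN]
    have hxi := abs_apply_le_lpNorm le_top x i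
    have hxy : x i * y i ≤ |x i| * |y i| := by rw [← abs_mul]; exact le_abs_self _
    split_ifs with hy
    · have := mul_le_mul_of_nonneg_right hxi (sub_pos.2 hy).le
      linarith
    · have := mul_le_mul_of_nonneg_left (not_lt.1 hy) (abs_nonneg (x i))
      linarith
  exact ⟨x', by linarith⟩

theorem not_isCapraConvex_lpNorm_top (hd : 2 ≤ d) :
    ¬ IsCapraConvex (lpNorm ∞) (ell0 d) := by
  intro h
  -- A vector with full support whose coordinates do not all have the same absolute value.
  let i₀ : Fin d := ⟨0, by omega⟩
  let x : Fin d → ℝ := fun i => if i = i₀ then 2 else 1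
  have hx : x ≠ 0 := fun h => by simpa [x] using congrFun h i₀
  have hl : l0 x = d := by
    have : supp x = Finset.univ := by
      ext i
      simp only [mem_supp, Finset.mem_univ, iff_true, x]
      split_ifs <;> norm_num
    simp [l0, this]
  have h1 : lpNorm 1 x = d + 1 := by
    have : ∀ i, |x i| = 1 + if i = i₀ then 1 else 0 := by
      intro i
      simp only [x]
      split_ifs <;> norm_num
    rw [lpNorm_one, Finset.sum_congr rfl fun i _ => this i, Finset.sum_add_distrib]
    simp
  have h2 : 2 ≤ lpNorm ∞ x := by simpa [x] using abs_apply_le_lpNorm le_top x i₀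
  have h3 := congrFun h x
  rw [biconjugate_ell0_lpNorm_top hx, ell0, EReal.coe_eq_coe_iff, hl, h1,
    div_eq_iff (by linarith)] at h3
  have h4 : (2 : ℝ) ≤ d := by exact_mod_cast hd
  nlinarith

theorem abs_eq_lpNorm_top_of_mem_subdifferential {x y : Fin d → ℝ}
    (hy : y ∈ subdifferential (lpNorm ∞) (ell0 d) x) {i : Fin d} (hi : i ∈ supp x) :
    |x i| = lpNorm ∞ x := by
  have hx : x ≠ 0 := by
    rintro rfl
    simp [mem_supp] at hi
  have hN := lpNorm_pos le_top hx
  rw [isDualNorm_top_one.mem_subdifferential_iff_forall_finset] at hy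
  have hM : ∀ K : Finset (Fin d), lpNorm 1 (restrict K y) = ∑ j ∈ K, |y j| := by
    intro K
    rw [lpNorm_restrict (by simp)]
    simp
  have hc : coupling (lpNorm ∞) x y
      ≤ ∑ j ∈ (supp x).erase i, |y j| + x i * y i / lpNorm ∞ x := by
    rw [← coupling_restrict (subset_refl (supp x)), coupling_of_ne_zero hx,
      dotProduct_restrict subset_rfl, dotProduct,
      ← Finset.sum_subset (Finset.subset_univ (supp x)) fun j _ hj => by
        rw [mem_supp, not_not] at hj
        simp [hj],
      ← Finset.sum_erase_add _ _ hi, add_div, Finset.sum_div]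
    gcongr with j
    rw [div_le_iff₀ hN]
    calc x j * y j ≤ |x j| * |y j| := by rw [← abs_mul]; exact le_abs_self _
      _ ≤ |y j| * lpNorm ∞ x := by
        rw [mul_comm]
        exact mul_le_mul_of_nonneg_left (abs_apply_le_lpNorm le_top x j) (abs_nonneg _)
  have h1 := hy (supp x)
  have h2 := hy ((supp x).erase i)
  rw [hM] at h1 h2
  rw [← Finset.sum_erase_add _ _ hi] at h1
  have hcard : (((supp x).erase i).card : ℝ) + 1 = (supp x).card := by
    exact_mod_cast Finset.card_erase_add_one hi
  have hl : (l0 x : ℝ) = (supp x).card := rfl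
  have h3 : |y i| ≤ x i * y i / lpNorm ∞ x := by linarith
  have h4 : 1 ≤ x i * y i / lpNorm ∞ x := by linarith
  have hy0 : 0 < |y i| := by
    rw [abs_pos]
    intro h0
    rw [h0, mul_zero, zero_div] at h4
    linarith
  refine le_antisymm (abs_apply_le_lpNorm le_top x i) ?_
  rw [le_div_iff₀ hN] at h3
  have h5 : x i * y i ≤ |x i| * |y i| := by rw [← abs_mul]; exact le_abs_self _
  exact le_of_mul_le_mul_left (by linarith) hy0

theorem subdifferentialDomain_lpNorm_top :
    subdifferentialDomain (lpNorm ∞) (ell0 d) =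
      {x | ∃ r : ℝ, 0 < r ∧ ∀ k : Fin d, x k ∈ ({-r, 0, r} : Set ℝ)} := by
  ext x
  rw [subdifferentialDomain, Set.mem_ofPred_eq, Set.mem_ofPred_eq]
  by_cases hx : x = 0
  · subst hx
    refine ⟨fun _ => ⟨1, one_pos, by simp⟩, fun _ => ⟨0, ?_⟩⟩
    rw [subdifferential_ell0_zero le_top, lpBall, Set.mem_ofPred_eq, lpNorm_zero le_top]
    exact zero_le_one
  constructor
  · rintro ⟨y, hy⟩
    refine ⟨lpNorm ∞ x, lpNorm_pos le_top hx, fun k => ?_⟩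
    by_cases hk : x k = 0
    · simp [hk]
    · have := abs_eq_lpNorm_top_of_mem_subdifferential hy (mem_supp.2 hk)
      rcases eq_or_eq_neg_of_abs_eq this with h | h
      · exact Or.inr (Or.inr h)
      · exact Or.inl h
  · rintro ⟨r, hr, h⟩
    refine ⟨signVec x, signVec_mem_subdifferential le_top hx ?_⟩
    have habs : ∀ k ∈ supp x, |x k| = r := by
      intro k hk
      rw [mem_supp] at hk
      rcases h k with h | h | h
      · rw [h, abs_neg, abs_of_pos hr]
      · exact absurd h hk
      · rw [h, abs_of_pos hr]
    have hN : lpNorm ∞ x = r := by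
      refine le_antisymm ((lpNorm_top_le_iff hr.le).2 fun k => ?_) ?_
      · by_cases hk : x k = 0
        · simpa [hk] using hr.le
        · exact (habs k (mem_supp.2 hk)).le
      · obtain ⟨k, hk⟩ := Finset.nonempty_iff_ne_empty.2 (mt supp_eq_empty.1 hx)
        rw [← habs k hk]
        exact abs_apply_le_lpNorm le_top x k
    have h1 : lpNorm 1 x = l0 x * r := by
      rw [lpNorm_one, ← Finset.sum_subset (Finset.subset_univ (supp x)) fun k _ hk => by
        rw [mem_supp, not_not] at hk
        simp [hk], Finset.sum_congr rfl habs]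
      simp [l0]
    rw [h1, hN, mul_div_assoc, div_self hr.ne', mul_one]

end Capra

/-! ### The three ranges of the exponent -/

theorem mainTheorem1 (d : ℕ) (hd : 1 ≤ d) :
    -- source norm `ℓ_1`
    ((2 ≤ d → ¬ IsCapraConvex (lpNorm 1) (ell0 d)) ∧
      (∀ x : Fin d → ℝ,
        (x = 0 → biconjugate (lpNorm 1) (ell0 d) x = 0) ∧
        (x ≠ 0 → biconjugate (lpNorm 1) (ell0 d) x = 1)) ∧
      subdifferentialDomain (lpNorm 1) (ell0 d) = {x | l0 x ≤ 1} ∧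
      subdifferential (lpNorm 1) (ell0 d) 0 = lpBall d ∞ ∧
      (∀ x : Fin d → ℝ, l0 x = 1 →
        subdifferential (lpNorm 1) (ell0 d) x =
          normalCone (lpBall d 1) ((lpNorm 1 x)⁻¹ • x) ∩ {y | 1 ≤ lpNorm ∞ y})) ∧
    -- source norm `ℓ_p` with `1 < p < ∞`
    (∀ p q : ℝ≥0∞, 1 < p → p < ∞ → 1 / p + 1 / q = 1 →
      IsCapraConvex (lpNorm p) (ell0 d) ∧
      subdifferentialDomain (lpNorm p) (ell0 d) = Set.univ ∧
      subdifferential (lpNorm p) (ell0 d) 0 = lpBall d ∞ ∧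
      (∀ x : Fin d → ℝ, x ≠ 0 → ∀ (y : Fin d → ℝ) (ν : Equiv.Perm (Fin d)),
        IsDecreasingOrder y ν →
        (y ∈ subdifferential (lpNorm p) (ell0 d) x ↔
          restrict (supp x) y ∈ normalCone (lpBall d p) ((lpNorm p x)⁻¹ • x) ∧
          (∀ j ∉ supp x, ∀ i ∈ supp x, |y j| ≤ |y i|) ∧
          (∀ k : Fin d, k.val < l0 x →
            |y (ν k)| ^ q.toReal ≥
              (topNorm k.val q y + 1) ^ q.toReal - (topNorm k.val q y) ^ q.toReal) ∧
          (∀ h : l0 x < d,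
            |y (ν ⟨l0 x, h⟩)| ^ q.toReal ≤
              (topNorm (l0 x) q y + 1) ^ q.toReal - (topNorm (l0 x) q y) ^ q.toReal)))) ∧
    -- source norm `ℓ_∞`
    ((2 ≤ d → ¬ IsCapraConvex (lpNorm ∞) (ell0 d)) ∧
      (∀ x : Fin d → ℝ,
        (x = 0 → biconjugate (lpNorm ∞) (ell0 d) x = 0) ∧
        (x ≠ 0 → biconjugate (lpNorm ∞) (ell0 d) x =
          ((lpNorm 1 x / lpNorm ∞ x : ℝ) : EReal))) ∧
      subdifferentialDomain (lpNorm ∞) (ell0 d) =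
        {x | ∃ r : ℝ, 0 < r ∧ ∀ k : Fin d, x k ∈ ({-r, 0, r} : Set ℝ)} ∧
      subdifferentialDomain (lpNorm ∞) (ell0 d) =
        (⋃ r ∈ Set.Ioi (0 : ℝ), Set.univ.pi fun _ : Fin d => ({-r, 0, r} : Set ℝ)) ∧
      subdifferential (lpNorm ∞) (ell0 d) 0 = lpBall d ∞ ∧
      (∀ x ∈ (⋃ r ∈ Set.Ioi (0 : ℝ), Set.univ.pi fun _ : Fin d => ({-r, 0, r} : Set ℝ)) \ {0},
        ∀ (y : Fin d → ℝ) (ν : Equiv.Perm (Fin d)), IsDecreasingOrder y ν →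
        (y ∈ subdifferential (lpNorm ∞) (ell0 d) x ↔
          restrict (supp x) y ∈ normalCone (lpBall d ∞) ((lpNorm ∞ x)⁻¹ • x) ∧
          (∀ j ∉ supp x, ∀ i ∈ supp x, |y j| ≤ |y i|) ∧
          (∀ k : Fin d, k.val < l0 x → |y (ν k)| ≥ 1) ∧
          (∀ h : l0 x < d, |y (ν ⟨l0 x, h⟩)| ≤ 1)))) := by
  refine ⟨⟨not_isCapraConvex_lpNorm_one, fun x => ⟨?_, biconjugate_ell0_lpNorm_one hd⟩,
    subdifferentialDomain_lpNorm_one hd, subdifferential_ell0_zero le_rfl,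
    fun x => subdifferential_lpNorm_one hd⟩, fun p q hp hp' hpq => ?_,
    not_isCapraConvex_lpNorm_top, fun x => ⟨?_, biconjugate_ell0_lpNorm_top⟩,
    subdifferentialDomain_lpNorm_top, ?_, subdifferential_ell0_zero le_top, ?_⟩
  · rintro rfl
    exact biconjugate_ell0_zero le_rfl
  · have h := toReal_holderConjugate hp hp' hpq
    have hq : q ≠ ∞ := by
      rintro rfl
      simpa using h.symm.pos
    have hq0 : 1 ≤ q :=
      (ENNReal.toReal_le_toReal ENNReal.one_ne_top hq).1 (by simpa using h.symm.lt.le)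
    have hdom := subdifferentialDomain_lpNorm_of_holderConjugate (d := d) hp.le hq0 h
    refine ⟨funext fun x => ?_, hdom, subdifferential_ell0_zero hp.le, fun x hx y ν hν =>
      mem_subdifferential_iff_topNorm (isDualNorm_of_holderConjugate hp.le hq0 h) hq0 hq hx hν⟩
    obtain ⟨y, hy⟩ : x ∈ subdifferentialDomain (lpNorm p) (ell0 d) := hdom ▸ Set.mem_univ x
    exact biconjugate_ell0_eq_of_mem_subdifferential hy
  · rintro rfl
    exact biconjugate_ell0_zero le_top
  · rw [subdifferentialDomain_lpNorm_top]
    ext x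
    simp
  · rintro x ⟨-, hx⟩ y ν hν
    -- With `q = 1` the increment `(T + 1) ^ q - T ^ q` is equal to one, whatever `T` is.
    simpa using mem_subdifferential_iff_topNorm isDualNorm_top_one le_rfl ENNReal.one_ne_top hx hν
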